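/- For $n\in\mathbb N$ and $X,Y\in\{0,1\}^n$ let $d_H(X,Y)=|\{i\in[n]:X_i\neq Y_i\}|/n$ (and $d_H=0$ if $n=0$). For distributions $D_1,D_2$ over $\{0,1\}^n$ let $d_{EM}(D_1,D_2)$ be the Earth Mover Distance, that is, the minimum of $\sum_{X,Y}f_{XY}\,d_H(X,Y)$ over all $f_{XY}\in[0,1]$ with $\sum_Y f_{XY}=D_1(X)$ for every $X$ and $\sum_X f_{XY}=D_2(Y)$ for every $Y$. For a permutation $\sigma$ of $[n]$, let $D_\sigma$ be the distribution with $D_\sigma(w_{\sigma(1)},\dots,w_{\sigma(n)})=D(w_1,\dots,w_n)$ for all $w$. A distribution $D$ over $\{0,1\}^n$ is $(\alpha,r)$-clusterable if there are $s\le r$ and a partition of $\{0,1\}^n$ into (possibly empty) sets $C_0,\dots,C_s$ with $D(C_0)=0$ and $d_H(U,V)\le\alpha$ for all $U,V\in C_i$ and all $1\le i\le s$. It is $\beta$-close to being $(\alpha,r)$-clusterable if $d_{EM}(D,D_0)\le\beta$ for some $(\alpha,r)$-clusterable distribution $D_0$. A non-adaptive algorithm with sample and query access to $D$ tosses random coins,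 determines from the coins alone sets $J_1,\dots,J_s\subseteq[n]$, takes $s$ independent samples $V_1,\dots,V_s$ from $D$ (independent of the coins), reads the bits of each $V_i$ at the positions in $J_i$, and computes its output from the coins and these bits. Its number of queries is $\sum_i|J_i|$. There is no restriction on its computation. **Theorem.** There exist a function $q$ and a non-adaptive algorithm that takes as inputs $n,r\in\mathbb N$ and real numbers $\alpha,\beta$ with $0<\beta<\alpha$ and $\varepsilon:=17(3\alpha+\beta/\alpha)<1$, has sample and query access to an unknown distribution $D$ over $\{0,1\}^n$, makes at most $q(\alpha,\beta,r)$ queries (a bound that does not depend on $n$ or $D$), and outputs either a distribution over $\{0,1\}^n$ or FAIL, such that for all such inputs: 1. If $D$ is $\beta$-close to being $(\alpha,r)$-clusterable, then with probability at least $2/3$ the algorithm outputs a distribution $D'$ such that $d_{EM}(D,D'_\sigma)\le\varepsilon$ for some permutation $\sigma$ of $[n]$. 2. For every distribution $D$ over $\{0,1\}^n$, the probability that the algorithm outputs a distribution $D'$ such that $d_{EM}(D,D'_\sigma)>\varepsilon$ for every permutation $\sigma$ of $[n]$ is at most $1/3$. -/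

import Mathlib

namespace HugeObject

/-- The Hamming cube `{0,1}^n`. -/
abbrev Cube (n : ℕ) : Type := Fin n → Bool

/-- Probability distributions over `{0,1}^n`. -/
abbrev Distribution (n : ℕ) : Type := PMF (Cube n)

/-- Normalized Hamming distance (equal to `0` in the degenerate case `n = 0`). -/
noncomputable def dH {n : ℕ} (X Y : Cube n) : ℝ := (hammingDist X Y : ℝ) / (n : ℝ)

/-- Feasible flows of the linear program that defines the Earth Mover Distance. -/
structure IsFlow {n : ℕ} (D₁ D₂ : Distribution n) (f : Cube n → Cube n → ℝ) : Prop where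
  nonneg : ∀ X Y, 0 ≤ f X Y
  le_one : ∀ X Y, f X Y ≤ 1
  row_sum : ∀ X, ∑ Y, f X Y = (D₁ X).toReal
  col_sum : ∀ Y, ∑ X, f X Y = (D₂ Y).toReal

/-- Earth Mover Distance: the value of the minimization program. The feasible set is nonempty
(it contains the product flow) and compact, so that the infimum is a minimum. -/
noncomputable def dEM {n : ℕ} (D₁ D₂ : Distribution n) : ℝ :=
  sInf {c : ℝ | ∃ f : Cube n → Cube n → ℝ, IsFlow D₁ D₂ f ∧ c = ∑ X, ∑ Y, f X Y * dH X Y}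

/-- The distribution `D_σ`, with `D_σ (w_{σ(1)}, …, w_{σ(n)}) = D (w_1, …, w_n)`. -/
noncomputable def Distribution.permute {n : ℕ} (D : Distribution n) (σ : Equiv.Perm (Fin n)) :
    Distribution n :=
  D.map (fun w i => w (σ i))

/-- `D` is `(ζ, δ, r)`-clusterable: the cube is partitioned into `C_0, …, C_s` with `s ≤ r`
(parts may be empty), `D(C_0) ≤ ζ`, and `C_1, …, C_s` of diameter at most `δ`. -/
def IsClusterable {n : ℕ} (ζ δ : ℝ) (r : ℕ) (D : Distribution n) : Prop :=
  ∃ s : ℕ, s ≤ r ∧ ∃ C : Fin (s + 1) → Set (Cube n),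
    (⋃ i, C i) = Set.univ ∧ Pairwise (fun i j => Disjoint (C i) (C j)) ∧
    D.toMeasure.real (C 0) ≤ ζ ∧
    ∀ i, i ≠ 0 → ∀ U ∈ C i, ∀ V ∈ C i, dH U V ≤ δ

/-- `D` is `β`-close to being `(α, r)`-clusterable, where `(α, r)`-clusterable means
`(0, α, r)`-clusterable. -/
def IsCloseToClusterable {n : ℕ} (β α : ℝ) (r : ℕ) (D : Distribution n) : Prop :=
  ∃ D₀ : Distribution n, IsClusterable 0 α r D₀ ∧ dEM D D₀ ≤ β

/-- A randomized non-adaptive algorithm with sample and query access to a distribution over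
`{0,1}^n`. It tosses its coins (a uniformly random element `ω` of a finite set), fixes from them
alone the set of coordinates to be queried in each of its samples, and computes its output from
the coins and the answers to these queries. The output is a distribution over `{0,1}^n`, or
`none`, which stands for FAIL. -/
structure NonadaptiveLearner (n : ℕ) where
  Coins : Type
  [fintypeCoins : Fintype Coins]
  [nonemptyCoins : Nonempty Coins]
  /-- the number of samples -/
  samples : ℕ
  /-- `querySet ω i` is the set of coordinates queried in the `i`-th sample -/
  querySet : Coins → Fin samples → Finset (Fin n)
  output : (ω : Coins) → ((i : Fin samples) → {j // j ∈ querySet ω i} → Bool) →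
    Option (Distribution n)

namespace NonadaptiveLearner

attribute [instance] fintypeCoins nonemptyCoins

variable {n : ℕ}

instance (A : NonadaptiveLearner n) : MeasurableSpace A.Coins := ⊤

/-- The algorithm makes at most `q` queries in total, whatever its coins are. -/
def QueriesAtMost (A : NonadaptiveLearner n) (q : ℕ) : Prop :=
  ∀ ω : A.Coins, ∑ i, (A.querySet ω i).card ≤ q

/-- The result of a run with coins `ω` and samples `V`: only the queried bits are used. -/
def run (A : NonadaptiveLearner n) (ω : A.Coins) (V : Fin A.samples → Cube n) :
    Option (Distribution n) :=
  A.output ω (fun i j => V i j.1)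

/-- The joint law of the coins and the samples: the coins are uniform, the samples are
independent with law `D`, and they are independent of the coins. -/
noncomputable def law (A : NonadaptiveLearner n) (D : Distribution n) :
    MeasureTheory.Measure (A.Coins × (Fin A.samples → Cube n)) :=
  (PMF.uniformOfFintype A.Coins).toMeasure.prod
    (MeasureTheory.Measure.pi (fun _ : Fin A.samples => D.toMeasure))

/-- The probability that the result of the algorithm on input distribution `D` satisfies `P`. -/
noncomputable def prob (A : NonadaptiveLearner n) (D : Distribution n)
    (P : Option (Distribution n) → Prop) : ℝ :=
  (A.law D).real {x | P (A.run x.1 x.2)}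

end NonadaptiveLearner

end HugeObject

/-! Write the samples as the rows of a matrix. Its columns lie in a finite set whose size does not
depend on `n`, so boundedly many random coordinates determine the column frequencies up to `α` in
`ℓ¹`. Two matrices with close column frequencies agree, after a permutation of the coordinates, in
most columns, hence every row is close (`exists_perm_dH_le`). Querying the same few coordinates in
every sample thus determines all samples approximately, up to a common permutation.

The samples come in two batches. The first provides centres, and the nearby centre labels each point
of the cube. Because the second batch is independent of the centres, its label frequencies
approximate those under `D`. Coupling equal labels then bounds the earth mover distance from `D` to
the empirical distribution of the second batch, except for points far from all centres. The learner
therefore accepts only a matrix in which few rows of the second batch are far from the first. This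
makes every output reliable without any assumption on `D` (`exists_perm_dEM_le`).

If `D` is close to clusterable, the true samples usually pass this test, so the learner does not
fail: `IsCloseToClusterable.exists_label` provides at most `r + 1` labels, and both batches
reproduce their frequencies (`uncoveredFraction_le`). Each of the four bad events has probability at
most 1/12 by a second moment bound (`wprob_lOne_freq_gt`). Soundness needs only two of them. -/

namespace HugeObject

/-! ### Normalized Hamming distance -/

section Hamming

variable {n : ℕ}

lemma dH_nonneg (X Y : Cube n) : 0 ≤ dH X Y := by unfold dH; positivity

lemma dH_comm (X Y : Cube n) : dH X Y = dH Y X := by unfold dH; rw [hammingDist_comm]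

lemma dH_triangle (X Y Z : Cube n) : dH X Z ≤ dH X Y + dH Y Z := by
  unfold dH
  rw [← add_div]
  gcongr
  exact_mod_cast hammingDist_triangle X Y Z

lemma dH_le_one (X Y : Cube n) : dH X Y ≤ 1 := by
  unfold dH
  apply div_le_one_of_le₀ _ (by positivity)
  exact_mod_cast (hammingDist_le_card_fintype (x := X) (y := Y)).trans (by simp)

lemma dH_le_of_card_le {c : ℝ} (hn : 0 < n) {X Y : Cube n} {s : Finset (Fin n)}
    (hs : ∀ i, X i ≠ Y i → i ∈ s) (hc : (s.card : ℝ) ≤ c * n) : dH X Y ≤ c := by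
  unfold dH
  rw [div_le_iff₀ (by exact_mod_cast hn)]
  refine le_trans ?_ hc
  exact_mod_cast Finset.card_le_card fun i hi => hs i (by simpa using hi)

end Hamming

/-! ### Label distributions and their `ℓ¹` distance -/

section Masses

variable {Ω T : Type*} [Fintype Ω]

open Classical in
/-- The mass of the fibre of `g` over `c`, for weights `p`. -/
noncomputable def mass (p : Ω → ℝ) (g : Ω → T) (c : T) : ℝ := ∑ x, if g x = c then p x else 0

/-- The `ℓ¹` distance of two functions on a finite type. -/
noncomputable def lOne [Fintype T] (u v : T → ℝ) : ℝ := ∑ c, |u c - v c|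

lemma lOne_comm [Fintype T] (u v : T → ℝ) : lOne u v = lOne v u := by
  simp only [lOne, abs_sub_comm]

lemma lOne_triangle [Fintype T] (u v w : T → ℝ) : lOne u w ≤ lOne u v + lOne v w := by
  simp only [lOne, ← Finset.sum_add_distrib]
  exact Finset.sum_le_sum fun c _ => abs_sub_le _ _ _

lemma mass_nonneg {p : Ω → ℝ} (hp : ∀ x, 0 ≤ p x) (g : Ω → T) (c : T) : 0 ≤ mass p g c :=
  Finset.sum_nonneg fun x _ => by split_ifs <;> simp [hp]

lemma le_mass {p : Ω → ℝ} (hp : ∀ x, 0 ≤ p x) (g : Ω → T) (x : Ω) : p x ≤ mass p g (g x) := by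
  classical
  have := Finset.single_le_sum (f := fun y => if g y = g x then p y else 0)
    (fun y _ => by split_ifs <;> simp [hp]) (Finset.mem_univ x)
  simpa [mass] using this

lemma sum_mass_filter [Fintype T] (p : Ω → ℝ) (g : Ω → T) (P : T → Prop) [DecidablePred P] :
    ∑ c, (if P c then mass p g c else 0) = ∑ x, if P (g x) then p x else 0 := by
  classical
  have h : ∀ c, (if P c then mass p g c else 0) =
      ∑ x, if g x = c then (if P (g x) then p x else 0) else 0 := by
    intro c
    rw [mass]
    by_cases hc : P c
    · rw [if_pos hc]
      refine Finset.sum_congr rfl fun x _ => ?_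
      split_ifs with h1 h2
      · rfl
      · exact absurd (h1 ▸ hc) h2
      · rfl
    · rw [if_neg hc, eq_comm]
      refine Finset.sum_eq_zero fun x _ => ?_
      split_ifs with h1 h2
      · exact absurd (h1 ▸ h2) hc
      · rfl
      · rfl
  simp only [h]
  rw [Finset.sum_comm]
  simp

lemma sum_mass [Fintype T] (p : Ω → ℝ) (g : Ω → T) : ∑ c, mass p g c = ∑ x, p x := by
  simpa using sum_mass_filter p g (fun _ => True)

lemma sum_mul_label [Fintype T] (p : Ω → ℝ) (g : Ω → T) (u : T → ℝ) :
    ∑ x, p x * u (g x) = ∑ c, mass p g c * u c := by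
  classical
  simp only [mass, Finset.sum_mul]
  rw [Finset.sum_comm]
  exact Finset.sum_congr rfl fun x _ => by simp [ite_mul]

lemma sum_filter_le_add_lOne [Fintype T] (u v : T → ℝ) (P : T → Prop) [DecidablePred P] :
    ∑ c, (if P c then u c else 0) ≤ ∑ c, (if P c then v c else 0) + lOne u v := by
  rw [lOne, ← Finset.sum_add_distrib]
  refine Finset.sum_le_sum fun c _ => ?_
  split_ifs
  · linarith [le_abs_self (u c - v c)]
  · simp

end Masses

/-! ### Couplings that respect labels -/

section Coupling

variable {Ω Ω' T : Type*} [Fintype Ω] [Fintype Ω'] [Fintype T]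

/-- Every subcoupling can be completed to a coupling. -/
lemma exists_coupling_ge {p : Ω → ℝ} {q : Ω' → ℝ} (hp : ∑ x, p x = 1) (hq : ∑ y, q y = 1)
    {f : Ω → Ω' → ℝ} (hrow : ∀ x, ∑ y, f x y ≤ p x) (hcol : ∀ y, ∑ x, f x y ≤ q y) :
    ∃ e : Ω → Ω' → ℝ, (∀ x y, 0 ≤ e x y) ∧ (∀ x, ∑ y, (f x y + e x y) = p x) ∧
      (∀ y, ∑ x, (f x y + e x y) = q y) ∧ ∑ x, ∑ y, e x y = 1 - ∑ x, ∑ y, f x y := by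
  set R := 1 - ∑ x, ∑ y, f x y with hR
  set a : Ω → ℝ := fun x => p x - ∑ y, f x y with ha
  set b : Ω' → ℝ := fun y => q y - ∑ x, f x y with hb
  have ha0 : ∀ x, 0 ≤ a x := fun x => sub_nonneg.2 (hrow x)
  have hb0 : ∀ y, 0 ≤ b y := fun y => sub_nonneg.2 (hcol y)
  have hsa : ∑ x, a x = R := by simp only [ha, Finset.sum_sub_distrib, hp, hR]
  have hsb : ∑ y, b y = R := by
    simp only [hb, Finset.sum_sub_distrib, hq, hR]; rw [Finset.sum_comm]
  have hR0 : 0 ≤ R := hsa ▸ Finset.sum_nonneg fun x _ => ha0 x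
  -- The deficits are filled by their normalized product. If `R = 0`, all deficits vanish and the
  -- division by zero is harmless.
  have h1 : ∀ x, ∑ y, a x * b y / R = a x := by
    intro x
    rw [← Finset.sum_div, ← Finset.mul_sum, hsb]
    rcases hR0.eq_or_lt with h | h
    · have : a x = 0 :=
        (Finset.sum_eq_zero_iff_of_nonneg fun x _ => ha0 x).1 (hsa.trans h.symm) x (by simp)
      simp [this]
    · field_simp
  have h2 : ∀ y, ∑ x, a x * b y / R = b y := by
    intro y
    rw [← Finset.sum_div, ← Finset.sum_mul, hsa]
    rcases hR0.eq_or_lt with h | h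
    · have : b y = 0 :=
        (Finset.sum_eq_zero_iff_of_nonneg fun x _ => hb0 x).1 (hsb.trans h.symm) y (by simp)
      simp [this]
    · field_simp
  refine ⟨fun x y => a x * b y / R, fun x y => by have := ha0 x; have := hb0 y; positivity,
    fun x => ?_, fun y => ?_, ?_⟩
  · rw [Finset.sum_add_distrib, h1]; simp [ha]
  · rw [Finset.sum_add_distrib, h2]; simp [hb]
  · simp only [h1, hsa]

/-- Two distributions with labels have a coupling in which the labels agree except on a set of
mass at most the `ℓ¹` distance of the distributions of the labels. -/
lemma exists_coupling_labels [DecidableEq T] {p : Ω → ℝ} {q : Ω' → ℝ} (hp0 : ∀ x, 0 ≤ p x) (hq0 : ∀ y, 0 ≤ q y)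
    (hp : ∑ x, p x = 1) (hq : ∑ y, q y = 1) (g : Ω → T) (h : Ω' → T) :
    ∃ F : Ω → Ω' → ℝ, (∀ x y, 0 ≤ F x y) ∧ (∀ x, ∑ y, F x y = p x) ∧
      (∀ y, ∑ x, F x y = q y) ∧
      ∑ x, ∑ y, (if g x ≠ h y then F x y else 0) ≤ lOne (mass p g) (mass q h) := by
  set M : T → ℝ := fun c => max (mass p g c) (mass q h c) with hM
  have hM0 : ∀ c, 0 ≤ M c := fun c => le_max_of_le_left (mass_nonneg hp0 g c)
  -- Dividing by the larger of the two masses makes this a subcoupling that carries the smaller one,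
  -- the most that can be matched on each label.
  set f : Ω → Ω' → ℝ := fun x y => if g x = h y then p x * q y / M (g x) else 0 with hf
  have hf0 : ∀ x y, 0 ≤ f x y := by
    intro x y
    have := hp0 x; have := hq0 y; have := hM0 (g x)
    simp only [hf]; split_ifs <;> positivity
  have hrow' : ∀ x, ∑ y, f x y = p x * (mass q h (g x) / M (g x)) := by
    intro x
    rw [mass, Finset.sum_div, Finset.mul_sum]
    refine Finset.sum_congr rfl fun y _ => ?_
    by_cases hxy : g x = h y
    · simp [hf, hxy, mul_div_assoc]
    · simp [hf, hxy, Ne.symm hxy]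
  have hcol' : ∀ y, ∑ x, f x y = q y * (mass p g (h y) / M (h y)) := by
    intro y
    rw [mass, Finset.sum_div, Finset.mul_sum]
    refine Finset.sum_congr rfl fun x _ => ?_
    by_cases hxy : g x = h y
    · simp only [hf, hxy, if_true]; ring
    · simp [hf, hxy]
  obtain ⟨e, he0, her, hec, hes⟩ := exists_coupling_ge (f := f) hp hq
    (fun x => by
      rw [hrow']
      exact mul_le_of_le_one_right (hp0 x) (div_le_one_of_le₀ (le_max_right _ _) (hM0 _)))
    (fun y => by
      rw [hcol']
      exact mul_le_of_le_one_right (hq0 y) (div_le_one_of_le₀ (le_max_left _ _) (hM0 _)))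
  refine ⟨fun x y => f x y + e x y, fun x y => add_nonneg (hf0 x y) (he0 x y), her, hec, ?_⟩
  calc ∑ x, ∑ y, (if g x ≠ h y then f x y + e x y else 0) ≤ ∑ x, ∑ y, e x y := by
        refine Finset.sum_le_sum fun x _ => Finset.sum_le_sum fun y _ => ?_
        split_ifs with hxy
        · simp [hf, hxy]
        · exact he0 x y
    _ = ∑ c, mass p g c - ∑ c, mass p g c * (mass q h c / M c) := by
        rw [hes, sum_mass, hp, ← sum_mul_label p g fun c => mass q h c / M c]
        simp only [hrow']
    _ ≤ lOne (mass p g) (mass q h) := by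
        rw [lOne, ← Finset.sum_sub_distrib]
        refine Finset.sum_le_sum fun c _ => ?_
        have h1 := mass_nonneg hp0 g c
        have h2 := mass_nonneg hq0 h c
        simp only [hM]
        rcases le_total (mass p g c) (mass q h c) with h3 | h3
        · rw [max_eq_right h3]
          rcases h2.eq_or_lt with h4 | h4
          · rw [← h4] at h3 ⊢
            simp [le_antisymm h3 h1]
          · rw [div_self h4.ne']; simp
        · rw [max_eq_left h3]
          rcases h1.eq_or_lt with h4 | h4
          · simp [← h4]
          · rw [mul_div_cancel₀ _ h4.ne']; exact le_abs_self _

end Coupling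

/-! ### Earth mover distance and empirical distributions -/

section EarthMover

variable {n : ℕ}

lemma sum_toReal (D : Distribution n) : ∑ X, (D X).toReal = 1 := by
  have h := D.tsum_coe
  rw [tsum_fintype] at h
  rw [← ENNReal.toReal_sum fun X _ => D.apply_ne_top X, h, ENNReal.toReal_one]

lemma dEM_le_of_isFlow {D₁ D₂ : Distribution n} {f : Cube n → Cube n → ℝ} (hf : IsFlow D₁ D₂ f) :
    dEM D₁ D₂ ≤ ∑ X, ∑ Y, f X Y * dH X Y := by
  refine csInf_le ⟨0, ?_⟩ ⟨f, hf, rfl⟩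
  rintro c ⟨g, hg, rfl⟩
  exact Finset.sum_nonneg fun X _ => Finset.sum_nonneg fun Y _ =>
    mul_nonneg (hg.nonneg X Y) (dH_nonneg X Y)

lemma IsFlow.of_sums {D₁ D₂ : Distribution n} {f : Cube n → Cube n → ℝ}
    (h0 : ∀ X Y, 0 ≤ f X Y) (hr : ∀ X, ∑ Y, f X Y = (D₁ X).toReal)
    (hc : ∀ Y, ∑ X, f X Y = (D₂ Y).toReal) : IsFlow D₁ D₂ f where
  nonneg := h0
  le_one X Y := by
    refine (Finset.single_le_sum (fun Z _ => h0 X Z) (Finset.mem_univ Y)).trans ?_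
    rw [hr, ← sum_toReal D₁]
    exact Finset.single_le_sum (f := fun Z => (D₁ Z).toReal) (fun Z _ => ENNReal.toReal_nonneg)
      (Finset.mem_univ X)
  row_sum := hr
  col_sum := hc

lemma exists_isFlow_lt {D₁ D₂ : Distribution n} {c : ℝ} (h : dEM D₁ D₂ < c) :
    ∃ f, IsFlow D₁ D₂ f ∧ ∑ X, ∑ Y, f X Y * dH X Y < c := by
  have hne : {c : ℝ | ∃ f : Cube n → Cube n → ℝ, IsFlow D₁ D₂ f ∧
      c = ∑ X, ∑ Y, f X Y * dH X Y}.Nonempty := by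
    refine ⟨_, fun X Y => (D₁ X).toReal * (D₂ Y).toReal,
      .of_sums (fun _ _ => by positivity) (fun X => ?_) (fun Y => ?_), rfl⟩
    · rw [← Finset.mul_sum, sum_toReal, mul_one]
    · rw [← Finset.sum_mul, sum_toReal, one_mul]
  obtain ⟨_, ⟨f, hf, rfl⟩, hlt⟩ := exists_lt_of_csInf_lt hne h
  exact ⟨f, hf, hlt⟩

/-- The empirical distribution of a nonempty finite family of points. -/
noncomputable def empirical {k : ℕ} (Y : Fin (k + 1) → Cube n) : Distribution n :=
  (PMF.uniformOfFintype (Fin (k + 1))).map Y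

open Classical in
lemma empirical_apply {k : ℕ} (Y : Fin (k + 1) → Cube n) (Z : Cube n) :
    (empirical Y Z).toReal = ∑ j, if Y j = Z then ((k + 1 : ℕ) : ℝ)⁻¹ else 0 := by
  rw [empirical, PMF.map_apply, tsum_fintype, ENNReal.toReal_sum]
  · refine Finset.sum_congr rfl fun j _ => ?_
    by_cases h : Y j = Z
    · simp only [h, if_true, PMF.uniformOfFintype_apply, Fintype.card_fin]
      rw [ENNReal.toReal_inv, ENNReal.toReal_natCast]
    · simp [h, Ne.symm h]
  · intro j _
    split_ifs
    · exact PMF.apply_ne_top _ _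
    · simp

lemma empirical_permute {k : ℕ} (Y : Fin (k + 1) → Cube n) (σ : Equiv.Perm (Fin n)) :
    (empirical Y).permute σ = empirical fun j i => Y j (σ i) := by
  rw [empirical, Distribution.permute, PMF.map_comp]; rfl

/-- Coupling `D` with the indices instead of the points avoids any care for repetitions in `Y`; the
flow merges the indices of equal points. -/
lemma dEM_empirical_le (D : Distribution n) {k : ℕ} (Y : Fin (k + 1) → Cube n)
    {F : Cube n → Fin (k + 1) → ℝ} (h0 : ∀ X j, 0 ≤ F X j)
    (hr : ∀ X, ∑ j, F X j = (D X).toReal) (hc : ∀ j, ∑ X, F X j = ((k + 1 : ℕ) : ℝ)⁻¹) :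
    dEM D (empirical Y) ≤ ∑ X, ∑ j, F X j * dH X (Y j) := by
  classical
  refine (dEM_le_of_isFlow (f := fun X Z => ∑ j, if Y j = Z then F X j else 0)
    (.of_sums (fun X Z => ?_) (fun X => ?_) (fun Z => ?_))).trans_eq ?_
  · exact Finset.sum_nonneg fun j _ => by split_ifs <;> simp [h0]
  · rw [Finset.sum_comm]; simp [hr]
  · rw [Finset.sum_comm, empirical_apply]
    refine Finset.sum_congr rfl fun j _ => ?_
    split_ifs
    · exact hc j
    · simp
  · refine Finset.sum_congr rfl fun X _ => ?_
    simp only [Finset.sum_mul]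
    rw [Finset.sum_comm]
    exact Finset.sum_congr rfl fun j _ => by simp [ite_mul]

end EarthMover

/-! ### Matching colourings by a permutation -/

section Permutation

open Classical in
/-- Two colourings of a finite type agree, up to a permutation, except on a set whose size is at
most the `ℓ¹` distance of their colour counts. -/
lemma exists_perm_card_ne_le {ι T : Type*} [Fintype ι] [Fintype T] (f g : ι → T) :
    ∃ σ : Equiv.Perm ι, ((Finset.univ.filter fun x => f (σ x) ≠ g x).card : ℝ) ≤
      lOne (mass (fun _ => 1) f) (mass (fun _ => 1) g) := by
  set bad : Equiv.Perm ι → Finset ι := fun σ => Finset.univ.filter fun x => f (σ x) ≠ g x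
  have hmem : ∀ σ x, x ∈ bad σ ↔ f (σ x) ≠ g x := fun σ x =>
    Finset.mem_filter.trans (and_iff_right (Finset.mem_univ x))
  obtain ⟨σ, -, hσ⟩ := Finset.exists_min_image Finset.univ (fun σ => (bad σ).card)
    (Finset.univ_nonempty (α := Equiv.Perm ι))
  refine ⟨σ, ?_⟩
  -- Otherwise swapping `x` and `y` repairs `x` and spoils no good position, against minimality.
  have key : ∀ x y, f (σ x) ≠ g x → f (σ y) ≠ g y → f (σ y) ≠ g x := by
    intro x y hx hy hxy
    have hlt : bad (Equiv.swap x y |>.trans σ) ⊂ bad σ := by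
      rw [Finset.ssubset_iff_of_subset]
      · exact ⟨x, (hmem _ _).2 hx, by simp [hmem, hxy]⟩
      · intro z hz
        by_cases hzx : z = x
        · subst hzx; exact (hmem _ _).2 hx
        by_cases hzy : z = y
        · subst hzy; exact (hmem _ _).2 hy
        simpa [hmem, Equiv.swap_apply_of_ne_of_ne hzx hzy] using hz
    exact absurd (hσ _ (Finset.mem_univ _)) (not_le.2 (Finset.card_lt_card hlt))
  have hf : mass (fun _ => 1) f = mass (fun _ => (1 : ℝ)) fun x => f (σ x) := by
    funext c
    exact (Equiv.sum_comp σ fun x => if f x = c then (1 : ℝ) else 0).symm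
  have hcard : ((bad σ).card : ℝ) = ∑ c, ∑ x, if f (σ x) ≠ g x ∧ g x = c then (1 : ℝ) else 0 := by
    rw [Finset.sum_comm, Finset.card_filter]
    push_cast
    refine Finset.sum_congr rfl fun x _ => ?_
    by_cases h : f (σ x) = g x <;> simp [h]
  change ((bad σ).card : ℝ) ≤ _
  rw [hcard, hf, lOne]
  refine Finset.sum_le_sum fun c _ => ?_
  -- If some bad position wants the colour `c`, then by `key` no bad position holds it. So the bad
  -- positions wanting `c` number exactly the difference of the two counts of `c`.
  by_cases hc : ∃ x, f (σ x) ≠ g x ∧ g x = c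
  · obtain ⟨x, hx, rfl⟩ := hc
    rw [abs_sub_comm]
    refine le_trans ?_ (le_abs_self _)
    rw [mass, mass, ← Finset.sum_sub_distrib]
    refine Finset.sum_le_sum fun y _ => ?_
    have := key x y hx
    by_cases h1 : g y = g x <;> by_cases h2 : f (σ y) = g x <;> simp_all
  · push Not at hc
    rw [Finset.sum_eq_zero]
    · positivity
    · intro x _
      rw [if_neg]
      exact fun h => hc x h.1 h.2

end Permutation

/-! ### Independent samples as finite weighted sums, and concentration of frequencies -/

section Concentration

variable {Ω : Type*} [Fintype Ω]

/-- The weights of `k` independent samples. -/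
def prodWeight {Ω : Type*} (p : Ω → ℝ) (k : ℕ) (x : Fin k → Ω) : ℝ := ∏ i, p (x i)

lemma prodWeight_nonneg {Ω : Type*} {p : Ω → ℝ} (hp : ∀ x, 0 ≤ p x) {k : ℕ} (x : Fin k → Ω) :
    0 ≤ prodWeight p k x := Finset.prod_nonneg fun _ _ => hp _

lemma sum_prodWeight_succ (p : Ω → ℝ) (k : ℕ) (F : (Fin (k + 1) → Ω) → ℝ) :
    ∑ x, prodWeight p (k + 1) x * F x =
      ∑ y, ∑ x, p y * prodWeight p k x * F (Fin.cons y x) := by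
  rw [← Fintype.sum_prod_type', ← Equiv.sum_comp (Fin.consEquiv fun _ => Ω)]
  refine Finset.sum_congr rfl fun z _ => ?_
  simp [prodWeight, Fin.prod_univ_succ, Fin.consEquiv]

lemma sum_prodWeight {p : Ω → ℝ} (hp : ∑ x, p x = 1) (k : ℕ) : ∑ x, prodWeight p k x = 1 := by
  induction k with
  | zero => simp [prodWeight]
  | succ k ih =>
    have := sum_prodWeight_succ p k fun _ => 1
    simp only [mul_one, ← Finset.mul_sum, ih, hp] at this
    exact this

lemma sum_prodWeight_add (p : Ω → ℝ) (m k : ℕ) (F : (Fin (m + k) → Ω) → ℝ) :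
    ∑ x, prodWeight p (m + k) x * F x =
      ∑ y, ∑ x, prodWeight p m y * prodWeight p k x * F (Fin.append y x) := by
  rw [← Fintype.sum_prod_type', ← Equiv.sum_comp (Fin.appendEquiv m k)]
  refine Finset.sum_congr rfl fun z _ => ?_
  simp [prodWeight, Fin.prod_univ_add, Fin.appendEquiv]

/-- The cross terms vanish because the samples are independent and `a` has mean zero; the induction
splits off the first sample. -/
lemma second_moment {p : Ω → ℝ} (hp : ∑ x, p x = 1) {a : Ω → ℝ} (ha : ∑ x, p x * a x = 0)
    (k : ℕ) :
    ∑ x, prodWeight p k x * (∑ i, a (x i)) ^ 2 = k * ∑ x, p x * a x ^ 2 := by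
  induction k with
  | zero => simp
  | succ k ih =>
    rw [sum_prodWeight_succ]
    have : ∀ y, ∑ x, p y * prodWeight p k x * (∑ i, a ((Fin.cons y x : Fin (k + 1) → Ω) i)) ^ 2 =
        p y * a y ^ 2 + p y * a y * (2 * ∑ x, prodWeight p k x * ∑ i, a (x i)) +
          p y * (k * ∑ x, p x * a x ^ 2) := by
      intro y
      have e1 : p y * a y ^ 2 = p y * a y ^ 2 * ∑ x, prodWeight p k x := by
        rw [sum_prodWeight hp, mul_one]
      rw [← ih, e1]
      simp only [Finset.mul_sum, ← Finset.sum_add_distrib, Fin.sum_univ_succ, Fin.cons_zero,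
        Fin.cons_succ]
      refine Finset.sum_congr rfl fun x _ => ?_
      rw [← Finset.mul_sum, ← Finset.mul_sum, ← Finset.mul_sum]
      ring
    simp only [this, Finset.sum_add_distrib, ← Finset.sum_mul, ha, hp]
    push_cast
    ring

/-- The empirical frequencies of the labels `y`. -/
noncomputable def freq {ι T : Type*} [Fintype ι] (y : ι → T) (c : T) : ℝ :=
  mass (fun _ => (Fintype.card ι : ℝ)⁻¹) y c

open Classical in
/-- The total weight of an event. -/
noncomputable def wprob (w : Ω → ℝ) (P : Ω → Prop) : ℝ := ∑ x, if P x then w x else 0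

lemma wprob_mono {w : Ω → ℝ} (hw : ∀ x, 0 ≤ w x) {P Q : Ω → Prop} (h : ∀ x, P x → Q x) :
    wprob w P ≤ wprob w Q := by
  refine Finset.sum_le_sum fun x _ => ?_
  by_cases hP : P x
  · simp [hP, h x hP]
  · by_cases hQ : Q x <;> simp [hP, hQ, hw]

lemma wprob_or_le {w : Ω → ℝ} (hw : ∀ x, 0 ≤ w x) (P Q : Ω → Prop) :
    wprob w (fun x => P x ∨ Q x) ≤ wprob w P + wprob w Q := by
  rw [wprob, wprob, wprob, ← Finset.sum_add_distrib]
  refine Finset.sum_le_sum fun x _ => ?_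
  by_cases hP : P x <;> by_cases hQ : Q x <;> simp [hP, hQ, hw]

lemma wprob_not {w : Ω → ℝ} (hw : ∑ x, w x = 1) (P : Ω → Prop) :
    wprob w (fun x => ¬ P x) = 1 - wprob w P := by
  rw [wprob, wprob, ← hw, ← Finset.sum_sub_distrib]
  refine Finset.sum_congr rfl fun x _ => ?_
  by_cases hP : P x <;> simp [hP]

/-- Conditioning on the first component: a bound valid for each of its values survives averaging.
This allows labels that depend on the first batch. -/
lemma wprob_prod_le_of_right {Ω' : Type*} [Fintype Ω'] {u : Ω → ℝ} {v : Ω' → ℝ}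
    (hu : ∀ x, 0 ≤ u x) (hu1 : ∑ x, u x = 1) {P : Ω → Ω' → Prop} {c : ℝ}
    (h : ∀ x, wprob v (P x) ≤ c) :
    wprob (fun z : Ω × Ω' => u z.1 * v z.2) (fun z => P z.1 z.2) ≤ c := by
  rw [wprob, Fintype.sum_prod_type]
  calc _ = ∑ x, u x * wprob v (P x) := by simp only [wprob, Finset.mul_sum, mul_ite, mul_zero]
    _ ≤ ∑ x, u x * c := Finset.sum_le_sum fun x _ => mul_le_mul_of_nonneg_left (h x) (hu x)
    _ = c := by rw [← Finset.sum_mul, hu1, one_mul]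

lemma wprob_prod_le_of_left {Ω' : Type*} [Fintype Ω'] {u : Ω → ℝ} {v : Ω' → ℝ}
    (hv : ∀ x, 0 ≤ v x) (hv1 : ∑ x, v x = 1) {P : Ω → Ω' → Prop} {c : ℝ}
    (h : ∀ y, wprob u (fun x => P x y) ≤ c) :
    wprob (fun z : Ω × Ω' => u z.1 * v z.2) (fun z => P z.1 z.2) ≤ c := by
  refine le_of_eq_of_le ?_ (wprob_prod_le_of_right (P := fun y x => P x y) hv hv1 h)
  rw [wprob, wprob, ← Equiv.sum_comp (Equiv.prodComm Ω' Ω)]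
  refine Finset.sum_congr rfl fun z _ => ?_
  rw [mul_comm]
  rfl

lemma wprob_append (p : Ω → ℝ) (m k : ℕ) (P : (Fin m → Ω) → (Fin k → Ω) → Prop) :
    wprob (prodWeight p (m + k)) (fun V => P (fun i => V (Fin.castAdd k i))
        (fun j => V (Fin.natAdd m j))) =
      wprob (fun z : (Fin m → Ω) × (Fin k → Ω) => prodWeight p m z.1 * prodWeight p k z.2)
        (fun z => P z.1 z.2) := by
  classical
  have := sum_prodWeight_add p m k fun V => if P (fun i => V (Fin.castAdd k i))
        (fun j => V (Fin.natAdd m j)) then 1 else 0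
  simp only [mul_ite, mul_one, mul_zero, Fin.append_left, Fin.append_right] at this
  rw [wprob, wprob, Fintype.sum_prod_type, this]

open Classical in
/-- The empirical frequencies of the labels of `k` independent samples are close in `ℓ¹` to the
distribution of the labels. -/
lemma wprob_lOne_freq_gt {T : Type*} [Fintype T] {p : Ω → ℝ} (hp0 : ∀ x, 0 ≤ p x)
    (hp : ∑ x, p x = 1) (g : Ω → T) {k : ℕ} {η : ℝ} (hη : 0 < η)
    {N : ℝ} (hN : (Fintype.card T : ℝ) ≤ N) (hk : 12 * N ^ 2 / η ^ 2 ≤ k) (hk0 : 0 < k) :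
    wprob (prodWeight p k) (fun x => η < lOne (freq fun i => g (x i)) (mass p g)) ≤ 1 / 12 := by
  have hkR : (0 : ℝ) < k := by exact_mod_cast hk0
  set a : T → Ω → ℝ := fun c x => (if g x = c then 1 else 0) - mass p g c with ha
  have hm1 : ∀ c, mass p g c ≤ 1 := by
    intro c
    rw [← hp]
    exact Finset.sum_le_sum fun x _ => by split_ifs <;> simp [hp0]
  have hE : ∀ c, ∑ x, p x * a c x = 0 := by
    intro c
    simp only [ha, mul_sub, Finset.sum_sub_distrib, ← Finset.sum_mul, hp, mass]
    simp
  have hV : ∀ c, ∑ x, p x * a c x ^ 2 ≤ 1 := by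
    intro c
    rw [← hp]
    refine Finset.sum_le_sum fun x _ => mul_le_of_le_one_right (hp0 x) ?_
    have := hm1 c
    have := mass_nonneg hp0 g c
    rw [sq_le_one_iff_abs_le_one, abs_le]
    simp only [ha]
    split_ifs <;> constructor <;> linarith
  have hfreq : ∀ (x : Fin k → Ω) c, freq (fun i => g (x i)) c - mass p g c =
      (∑ i, a c (x i)) / k := by
    intro x c
    simp only [freq, ha, Finset.sum_sub_distrib, sub_div, Finset.sum_const, Finset.card_univ,
      Fintype.card_fin, nsmul_eq_mul, mul_div_cancel_left₀ _ hkR.ne']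
    congr 1
    rw [mass, Finset.sum_div]
    exact Finset.sum_congr rfl fun i _ => by simp [ite_div]
  -- Cauchy–Schwarz over the labels reduces the `ℓ¹` deviation to variances. Each is at most `1 /
  -- k`, so Markov's inequality for the square gives the bound.
  have hsq : ∀ x : Fin k → Ω, lOne (freq fun i => g (x i)) (mass p g) ^ 2 ≤
      Fintype.card T * ∑ c, (∑ i, a c (x i)) ^ 2 / k ^ 2 := by
    intro x
    have := sq_sum_le_card_mul_sum_sq (s := Finset.univ)
      (f := fun c => |freq (fun i => g (x i)) c - mass p g c|)
    simpa only [sq_abs, hfreq, div_pow, lOne, Finset.card_univ] using this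
  have hmark : wprob (prodWeight p k) (fun x => η < lOne (freq fun i => g (x i)) (mass p g)) * η ^ 2
      ≤ Fintype.card T * (Fintype.card T / k) := by
    calc _ ≤ ∑ x, prodWeight p k x * (Fintype.card T * ∑ c, (∑ i, a c (x i)) ^ 2 / k ^ 2) := by
          rw [wprob, Finset.sum_mul]
          refine Finset.sum_le_sum fun x _ => ?_
          split_ifs with h
          · refine mul_le_mul_of_nonneg_left (le_trans ?_ (hsq x)) (prodWeight_nonneg hp0 x)
            gcongr
          · have := prodWeight_nonneg hp0 x
            rw [zero_mul]
            positivity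
      _ = Fintype.card T * ∑ c, (∑ x, prodWeight p k x * (∑ i, a c (x i)) ^ 2) / k ^ 2 := by
          simp only [Finset.mul_sum, Finset.sum_div]
          rw [Finset.sum_comm]
          exact Finset.sum_congr rfl fun c _ => Finset.sum_congr rfl fun x _ => by ring
      _ ≤ Fintype.card T * ∑ c : T, 1 / (k : ℝ) := by
          refine mul_le_mul_of_nonneg_left (Finset.sum_le_sum fun c _ => ?_) (by positivity)
          rw [second_moment hp (hE c)]
          rw [div_le_div_iff₀ (by positivity) hkR]
          nlinarith [hV c, mul_pos hkR hkR]
      _ = _ := by simp [div_eq_mul_inv]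
  rw [div_le_iff₀ (by positivity)] at hk
  have h3 : (Fintype.card T : ℝ) * (Fintype.card T / k) * k ≤ N ^ 2 := by
    field_simp
    gcongr
  have h4 : (12 * wprob (prodWeight p k) (fun x => η < lOne (freq fun i => g (x i)) (mass p g)))
      * (k * η ^ 2) ≤ 1 * (k * η ^ 2) := by nlinarith
  have := le_of_mul_le_mul_right h4 (by positivity)
  linarith

end Concentration

/-! ### The law of a run as a finite weighted sum -/

section Law

variable {n : ℕ}

/-- The probabilities of the points, as real numbers. -/
noncomputable def pointMass (D : Distribution n) (X : Cube n) : ℝ := (D X).toReal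

lemma pointMass_nonneg (D : Distribution n) (X : Cube n) : 0 ≤ pointMass D X :=
  ENNReal.toReal_nonneg

lemma sum_pointMass (D : Distribution n) : ∑ X, pointMass D X = 1 := sum_toReal D

instance NonadaptiveLearner.isProbabilityMeasure_law (A : NonadaptiveLearner n)
    (D : Distribution n) : MeasureTheory.IsProbabilityMeasure (A.law D) := by
  unfold NonadaptiveLearner.law; infer_instance

lemma NonadaptiveLearner.prob_eq_one (A : NonadaptiveLearner n) (D : Distribution n)
    {P : Option (Distribution n) → Prop} (h : ∀ ω V, P (A.run ω V)) : A.prob D P = 1 := by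
  have hu : {x : A.Coins × (Fin A.samples → Cube n) | P (A.run x.1 x.2)} = Set.univ :=
    Set.eq_univ_of_forall fun x => h x.1 x.2
  rw [NonadaptiveLearner.prob, hu, MeasureTheory.probReal_univ]

lemma NonadaptiveLearner.prob_eq (A : NonadaptiveLearner n) (D : Distribution n)
    (P : Option (Distribution n) → Prop) :
    A.prob D P = wprob (fun z : A.Coins × (Fin A.samples → Cube n) =>
      (Fintype.card A.Coins : ℝ)⁻¹ * prodWeight (pointMass D) A.samples z.2)
      (fun z => P (A.run z.1 z.2)) := by
  classical
  have : DiscreteMeasurableSpace A.Coins := ⟨fun _ => trivial⟩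
  rw [NonadaptiveLearner.prob, wprob, ← Finset.sum_filter]
  have hS : {x : A.Coins × (Fin A.samples → Cube n) | P (A.run x.1 x.2)} =
      ↑(Finset.univ.filter fun x : A.Coins × (Fin A.samples → Cube n) => P (A.run x.1 x.2)) := by
    ext; simp
  rw [hS, ← MeasureTheory.sum_measureReal_singleton]
  refine Finset.sum_congr rfl fun z _ => ?_
  obtain ⟨ω, V⟩ := z
  rw [MeasureTheory.measureReal_def, NonadaptiveLearner.law, ← Set.singleton_prod_singleton,
    MeasureTheory.Measure.prod_prod, MeasureTheory.Measure.pi_singleton,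
    PMF.toMeasure_apply_singleton _ _ (MeasurableSet.singleton _), ENNReal.toReal_mul,
    ENNReal.toReal_prod, PMF.uniformOfFintype_apply, ENNReal.toReal_inv, ENNReal.toReal_natCast]
  congr 1
  refine Finset.prod_congr rfl fun i _ => ?_
  rw [PMF.toMeasure_apply_singleton _ _ (MeasurableSet.singleton _)]
  rfl

end Law

/-! ### Cluster labels from closeness to a clusterable distribution -/

section Clusters

variable {n : ℕ}

open Classical in
/-- A distribution close to a clusterable one admits a labelling of the cube by cluster indices,
with the index `0` for a set of small mass. -/
lemma IsCloseToClusterable.exists_label {β α : ℝ} {r : ℕ} {D : Distribution n} (hα : 0 < α)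
    (h : IsCloseToClusterable β α r D) :
    ∃ s ≤ r, ∃ g : Cube n → Fin (s + 1), mass (pointMass D) g 0 ≤ β / α + α ∧
      ∀ X Y, g X = g Y → g X ≠ 0 → dH X Y ≤ 3 * α := by
  obtain ⟨D₀, ⟨s, hs, C, hU, -, hC0, hdiam⟩, hd⟩ := h
  -- The slack `α ^ 2` spares the existence of an optimal flow; divided by `α`, it is the extra `α`
  -- in the mass of label `0`.
  obtain ⟨f, hf, hcost⟩ := exists_isFlow_lt (c := β + α ^ 2) (hd.trans_lt (by nlinarith))
  have hzero : ∀ Y ∈ C 0, ∀ X, f X Y = 0 := by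
    intro Y hY X
    have h1 : (D₀ Y).toReal ≤ 0 := by
      refine le_trans ?_ hC0
      rw [← PMF.toMeasure_apply_singleton D₀ Y (MeasurableSet.singleton _)]
      exact MeasureTheory.measureReal_mono (Set.singleton_subset_iff.2 hY)
    rw [← hf.col_sum] at h1
    have h2 := Finset.single_le_sum (fun Z _ => hf.nonneg Z Y) (Finset.mem_univ X)
    exact le_antisymm (h2.trans h1) (hf.nonneg X Y)
  refine ⟨s, hs, fun X => if h : ∃ i, i ≠ 0 ∧ ∃ U ∈ C i, dH X U ≤ α then h.choose else 0, ?_, ?_⟩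
  -- Mass with label `0` is farther than `α` from every cluster and nothing flows into `C 0`, so
  -- each unit of it costs at least `α`.
  · have key : mass (pointMass D) (fun X => if h : ∃ i, i ≠ 0 ∧ ∃ U ∈ C i, dH X U ≤ α
        then h.choose else 0) 0 * α ≤ ∑ X, ∑ Y, f X Y * dH X Y := by
      rw [mass, Finset.sum_mul]
      refine Finset.sum_le_sum fun X _ => ?_
      split_ifs with h1 h2
      · exact absurd h2 h1.choose_spec.1
      · exact (zero_mul α).trans_le <|
          Finset.sum_nonneg fun Y _ => mul_nonneg (hf.nonneg X Y) (dH_nonneg X Y)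
      · rw [pointMass, ← hf.row_sum, Finset.sum_mul]
        refine Finset.sum_le_sum fun Y _ => ?_
        obtain ⟨i, hi⟩ : ∃ i, Y ∈ C i := by
          simpa using (hU.symm ▸ Set.mem_univ Y : Y ∈ ⋃ i, C i)
        by_cases hi0 : i = 0
        · subst hi0; simp [hzero Y hi X]
        · refine mul_le_mul_of_nonneg_left ?_ (hf.nonneg X Y)
          by_contra hlt
          exact h1 ⟨i, hi0, Y, hi, (not_le.1 hlt).le⟩
      · exact absurd rfl ‹_›
    have h2 : β / α + α = (β + α ^ 2) / α := by field_simp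
    rw [h2, le_div_iff₀ hα]
    exact key.trans hcost.le
  · intro X Y hXY hX
    dsimp only at hXY hX
    split_ifs at hXY hX with h1 h2
    · obtain ⟨-, U, hU, hXU⟩ := h1.choose_spec
      obtain ⟨hne, U', hU', hYU⟩ := h2.choose_spec
      rw [hXY] at hU
      have h3 := hdiam _ hne U hU U' hU'
      have h4 := dH_triangle X U Y
      have h5 := dH_triangle U U' Y
      rw [dH_comm U' Y] at h5
      linarith
    · exact absurd hXY hX
    all_goals exact absurd rfl hX

end Clusters

/-! ### Centres, candidates and the output rule -/

section Algorithm

variable {n m k t : ℕ}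

/-- The first `m` points of a family of `m + k` points. -/
def firstBatch (V : Fin (m + k) → Cube n) (i : Fin m) : Cube n := V (Fin.castAdd k i)

/-- The last `k` points of a family of `m + k` points. -/
def secondBatch (V : Fin (m + k) → Cube n) (j : Fin k) : Cube n := V (Fin.natAdd m j)

/-- The columns of the matrix with rows `V`. -/
def columns {s : ℕ} (V : Fin s → Cube n) (x : Fin n) (i : Fin s) : Bool := V i x

/-- The fraction of the points `Y` farther than `δ` from all of the points `U`. -/
noncomputable def uncoveredFraction (δ : ℝ) (U : Fin m → Cube n) (Y : Fin k → Cube n) : ℝ :=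
  wprob (fun _ : Fin k => (k : ℝ)⁻¹) fun j => ∀ l, δ < dH (U l) (Y j)

open Classical in
/-- The index of some point of `U` within distance `δ` of `X`, if there is one. -/
noncomputable def nearIndex (δ : ℝ) (U : Fin m → Cube n) (X : Cube n) : Option (Fin m) :=
  if h : ∃ l, dH (U l) X ≤ δ then some h.choose else none

lemma dH_le_of_nearIndex_eq_some {δ : ℝ} {U : Fin m → Cube n} {X : Cube n} {l : Fin m}
    (h : nearIndex δ U X = some l) : dH (U l) X ≤ δ := by
  unfold nearIndex at h
  split_ifs at h with h1
  rw [← Option.some_injective _ h]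
  exact h1.choose_spec

lemma lt_dH_of_nearIndex_eq_none {δ : ℝ} {U : Fin m → Cube n} {X : Cube n}
    (h : nearIndex δ U X = none) (l : Fin m) : δ < dH (U l) X := by
  unfold nearIndex at h
  split_ifs at h with h1
  push Not at h1
  exact h1 l

/-- The families of points that the learner considers to be consistent with the observed
columns `τ`. -/
def IsCandidate (α θ : ℝ) (τ : Fin t → Fin (m + k) → Bool) (W : Fin (m + k) → Cube n) : Prop :=
  lOne (freq (columns W)) (freq τ) ≤ α ∧
    uncoveredFraction (3 * α) (firstBatch W) (secondBatch W) ≤ θ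

open Classical in
/-- The empirical distribution of the second batch of a candidate, if there is a candidate. -/
noncomputable def learnFromColumns (n : ℕ) (α θ : ℝ) (τ : Fin t → Fin (m + (k + 1)) → Bool) :
    Option (Distribution n) :=
  if h : ∃ W : Fin (m + (k + 1)) → Cube n, IsCandidate α θ τ W then
    some (empirical (secondBatch h.choose)) else none

lemma exists_candidate_of_learnFromColumns {α θ : ℝ} {τ : Fin t → Fin (m + (k + 1)) → Bool}
    {D' : Distribution n} (h : learnFromColumns n α θ τ = some D') :
    ∃ W, IsCandidate α θ τ W ∧ D' = empirical (secondBatch W) := by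
  unfold learnFromColumns at h
  split_ifs at h with h1
  exact ⟨_, h1.choose_spec, (Option.some_injective _ h).symm⟩

lemma exists_learnFromColumns_eq_some {α θ : ℝ} {τ : Fin t → Fin (m + (k + 1)) → Bool}
    {V : Fin (m + (k + 1)) → Cube n} (h : IsCandidate α θ τ V) :
    ∃ D', learnFromColumns n α θ τ = some D' := by
  unfold learnFromColumns
  rw [dif_pos ⟨V, h⟩]
  exact ⟨_, rfl⟩

/-! ### From column frequencies to earth mover distance -/

lemma lOne_mass_one_eq {ι T : Type*} [Fintype ι] [Nonempty ι] [Fintype T] (f g : ι → T) :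
    lOne (mass (fun _ => 1) f) (mass (fun _ => 1) g) =
      lOne (freq f) (freq g) * Fintype.card ι := by
  have h : (0 : ℝ) < Fintype.card ι := by exact_mod_cast Fintype.card_pos
  have h1 : ∀ (f : ι → T) c, mass (fun _ => 1) f c = freq f c * Fintype.card ι := by
    intro f c
    rw [freq, mass, mass, Finset.sum_mul]
    exact Finset.sum_congr rfl fun x _ => by simp [ite_mul, h.ne']
  rw [lOne, lOne, Finset.sum_mul]
  refine Finset.sum_congr rfl fun c _ => ?_
  rw [h1, h1, ← sub_mul, abs_mul, abs_of_pos h]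

/-- Families of points with similar frequencies of columns are close up to a permutation of the
coordinates. -/
lemma exists_perm_dH_le {s : ℕ} {η : ℝ} {V W : Fin s → Cube (n + 1)}
    (h : lOne (freq (columns W)) (freq (columns V)) ≤ η) :
    ∃ σ : Equiv.Perm (Fin (n + 1)), ∀ i, dH (fun x => W i (σ x)) (V i) ≤ η := by
  classical
  obtain ⟨σ, hσ⟩ := exists_perm_card_ne_le (columns W) (columns V)
  refine ⟨σ, fun i => dH_le_of_card_le n.succ_pos
    (s := Finset.univ.filter fun x => columns W (σ x) ≠ columns V x) (fun x hx => ?_) ?_⟩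
  · rw [Finset.mem_filter]
    exact ⟨Finset.mem_univ x, fun he => hx (congrFun he i)⟩
  · refine (le_of_eq ?_).trans (hσ.trans ?_)
    · congr!
    · rw [lOne_mass_one_eq, Fintype.card_fin]
      gcongr

lemma dH_comp_perm (X Y : Cube n) (σ : Equiv.Perm (Fin n)) :
    dH (fun x => X (σ x)) (fun x => Y (σ x)) = dH X Y := by
  unfold dH hammingDist
  congr 2
  refine Finset.card_bij (fun x _ => σ x) (by simp) (by simp) fun y hy => ⟨σ.symm y, ?_⟩
  simpa using hy

/-- The core of soundness, for arbitrary `D`. Points are coupled with second-batch indices by their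
centre among the true samples `V`; indices without a centre are charged to the uncovered fraction of
the candidate `W`. -/
lemma exists_perm_dEM_le {α θ : ℝ} {D : Distribution (n + 1)}
    {V W : Fin (m + (k + 1)) → Cube (n + 1)}
    (hVW : lOne (freq (columns W)) (freq (columns V)) ≤ 2 * α)
    (hW : uncoveredFraction (3 * α) (firstBatch W) (secondBatch W) ≤ θ)
    (hV : lOne (freq fun j => nearIndex (7 * α) (firstBatch V) (secondBatch V j))
      (mass (pointMass D) (nearIndex (7 * α) (firstBatch V))) ≤ α) :
    ∃ σ : Equiv.Perm (Fin (n + 1)),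
      dEM D ((empirical (secondBatch W)).permute σ) ≤ 17 * α + θ := by
  classical
  obtain ⟨σ, hσ⟩ := exists_perm_dH_le hVW
  refine ⟨σ, ?_⟩
  have hα : 0 ≤ α := by
    have := (dH_nonneg _ _).trans (hσ (Fin.natAdd m 0)); linarith
  set g := nearIndex (7 * α) (firstBatch V)
  set h : Fin (k + 1) → Option (Fin m) := fun j => g (secondBatch V j)
  obtain ⟨F, hF0, hFr, hFc, hFne⟩ := exists_coupling_labels (pointMass_nonneg D)
    (q := fun _ : Fin (k + 1) => ((k + 1 : ℕ) : ℝ)⁻¹) (fun _ => by positivity)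
    (sum_pointMass D) (by simp [mul_inv_cancel₀ (show ((k : ℝ) + 1) ≠ 0 by positivity)]) g h
  rw [empirical_permute]
  refine (dEM_empirical_le D _ hF0 hFr hFc).trans ?_
  -- This explains the radius `7 * α`: both endpoints move by at most `2 * α` between `V` and the
  -- permuted `W`, which leaves `3 * α`.
  have hfar : ∀ j, h j = none → ∀ l, 3 * α < dH (firstBatch W l) (secondBatch W j) := by
    intro j hj l
    have h1 := lt_dH_of_nearIndex_eq_none hj l
    rw [← dH_comp_perm (firstBatch W l) (secondBatch W j) σ]
    have h2 := dH_triangle (firstBatch V l) (fun x => firstBatch W l (σ x)) (secondBatch V j)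
    have h3 := dH_triangle (fun x => firstBatch W l (σ x)) (fun x => secondBatch W j (σ x))
      (secondBatch V j)
    have h4 : dH (fun x => firstBatch W l (σ x)) (firstBatch V l) ≤ _ := hσ (Fin.castAdd _ l)
    have h5 : dH (fun x => secondBatch W j (σ x)) (secondBatch V j) ≤ _ := hσ (Fin.natAdd m j)
    rw [dH_comm] at h4
    linarith
  -- A shared centre costs `7 + 7 + 2 = 16` times `α`: from `X` to the centre, to the sample, to its
  -- counterpart in `W`. In the other cases the distance is bounded by 1.
  have hpoint : ∀ X j, F X j * dH X (fun i => secondBatch W j (σ i)) ≤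
      F X j * (16 * α) + (if g X ≠ h j then F X j else 0) +
        (if ∀ l, 3 * α < dH (firstBatch W l) (secondBatch W j) then F X j else 0) := by
    intro X j
    have h0 := hF0 X j
    have h1 : F X j * dH X (fun i => secondBatch W j (σ i)) ≤ F X j :=
      mul_le_of_le_one_right h0 (dH_le_one _ _)
    have h2 : 0 ≤ F X j * (16 * α) := by positivity
    by_cases hne : g X = h j
    · rcases hj : h j with _ | l
      · rw [if_pos (hfar j hj)]
        split_ifs <;> linarith
      · have h3 := dH_le_of_nearIndex_eq_some (hne.trans hj)
        have h4 := dH_le_of_nearIndex_eq_some hj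
        have h5 : dH (fun x => secondBatch W j (σ x)) (secondBatch V j) ≤ _ := hσ (Fin.natAdd m j)
        rw [dH_comm] at h3 h5
        have h6 := dH_triangle X (firstBatch V l) (fun x => secondBatch W j (σ x))
        have h7 := dH_triangle (firstBatch V l) (secondBatch V j)
          (fun x => secondBatch W j (σ x))
        have h8 : F X j * dH X (fun i => secondBatch W j (σ i)) ≤ F X j * (16 * α) :=
          mul_le_mul_of_nonneg_left (by linarith) h0
        split_ifs <;> linarith
    · rw [if_pos hne]
      split_ifs <;> linarith
  calc _ ≤ ∑ X, ∑ j, (F X j * (16 * α) + (if g X ≠ h j then F X j else 0) +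
        (if ∀ l, 3 * α < dH (firstBatch W l) (secondBatch W j) then F X j else 0)) :=
        Finset.sum_le_sum fun X _ => Finset.sum_le_sum fun j _ => hpoint X j
    _ ≤ 16 * α + α + θ := by
        simp only [Finset.sum_add_distrib]
        refine add_le_add (add_le_add (le_of_eq ?_) (hFne.trans ?_)) (le_trans (le_of_eq ?_) hW)
        · simp only [← Finset.sum_mul, hFr, sum_pointMass, one_mul]
        · rw [lOne_comm]
          have hfreq : freq h = mass (fun _ => ((k + 1 : ℕ) : ℝ)⁻¹) h := by
            funext c
            rw [freq, Fintype.card_fin]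
          rw [← hfreq]
          exact hV
        · rw [Finset.sum_comm, uncoveredFraction, wprob]
          refine Finset.sum_congr rfl fun j _ => ?_
          split_ifs
          · exact hFc j
          · simp
    _ = 17 * α + θ := by ring

/-- If the label frequencies of both batches are accurate, then few points of the second batch are
far from the first batch. -/
lemma uncoveredFraction_le {s : ℕ} {α δ ξ : ℝ} {p : Cube n → ℝ} {g : Cube n → Fin (s + 1)}
    (hp : ∀ X, 0 ≤ p X)
    (h0 : mass p g 0 ≤ ξ) (hg : ∀ X Y, g X = g Y → g X ≠ 0 → dH X Y ≤ δ)
    {U : Fin m → Cube n} {Y : Fin k → Cube n} (hm : 0 < m)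
    (hU : lOne (freq fun i => g (U i)) (mass p g) ≤ α)
    (hY : lOne (freq fun j => g (Y j)) (mass p g) ≤ α) :
    uncoveredFraction δ U Y ≤ ξ + 2 * α := by
  classical
  set u := freq fun i => g (U i) with hu
  have hu0 : ∀ i, u (g (U i)) ≠ 0 := by
    intro i
    have h1 : (0 : ℝ) < (Fintype.card (Fin m) : ℝ)⁻¹ := by
      rw [Fintype.card_fin]; positivity
    exact (h1.trans_le (le_mass (p := fun _ => (Fintype.card (Fin m) : ℝ)⁻¹) (fun _ => h1.le)
      (fun i => g (U i)) i)).ne'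
  -- An uncovered point has label `0` or a label missing from `U`. Missing labels have total mass at
  -- most `α`, and passing from the frequencies in `Y` to the masses costs another `α`.
  calc uncoveredFraction δ U Y
      ≤ wprob (fun _ : Fin k => (k : ℝ)⁻¹) fun j => g (Y j) = 0 ∨ u (g (Y j)) = 0 := by
        refine wprob_mono (fun _ => by positivity) fun j hj => ?_
        by_contra hcon
        push Not at hcon
        have hex : ∃ i, g (U i) = g (Y j) := by
          by_contra hno
          push Not at hno
          exact hcon.2 (by simp [hu, freq, mass, hno])
        obtain ⟨i, hi⟩ := hex
        exact absurd (hj i) (not_lt.2 (hg _ _ hi (hi ▸ hcon.1)))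
    _ = ∑ c, if c = 0 ∨ u c = 0 then freq (fun j => g (Y j)) c else 0 := by
        refine Eq.trans ?_ (sum_mass_filter _ _ fun c => c = 0 ∨ u c = 0).symm
        rw [wprob, Fintype.card_fin]
        congr!
    _ ≤ ∑ c, (if c = 0 ∨ u c = 0 then mass p g c else 0) + α :=
        (sum_filter_le_add_lOne _ (mass p g) fun c => c = 0 ∨ u c = 0).trans (by gcongr)
    _ ≤ (∑ c, (if c = 0 then mass p g c else 0) + ∑ c, if u c = 0 then mass p g c else 0) + α := by
        rw [← Finset.sum_add_distrib]
        gcongr with c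
        have := mass_nonneg hp g c
        by_cases h1 : c = 0 <;> by_cases h2 : u c = 0 <;> simp [h1, h2] <;>
          split_ifs <;> simp_all
    _ ≤ (ξ + α) + α := by
        gcongr
        · simpa using h0
        · refine (sum_filter_le_add_lOne _ u _).trans ?_
          rw [Finset.sum_eq_zero, zero_add, lOne_comm]
          · exact hU
          · intro c _
            split_ifs with h <;> simp [h]
    _ = ξ + 2 * α := by ring

/-! ### The learners as non-adaptive algorithms -/

/-- The learner that queries each of `s` samples at the same `t` random coordinates. -/
def uniformLearner (n s t : ℕ) (out : (Fin t → Fin s → Bool) → Option (Distribution (n + 1))) :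
    NonadaptiveLearner (n + 1) where
  Coins := Fin t → Fin (n + 1)
  samples := s
  querySet ω _ := Finset.univ.image ω
  output ω b := out fun c i => b i ⟨ω c, Finset.mem_image_of_mem ω (Finset.mem_univ c)⟩

lemma uniformLearner_queriesAtMost (n s t : ℕ)
    (out : (Fin t → Fin s → Bool) → Option (Distribution (n + 1))) :
    (uniformLearner n s t out).QueriesAtMost (s * t) := by
  intro ω
  refine (Finset.sum_le_card_nsmul Finset.univ _ t fun i _ => ?_).trans_eq
    (by rw [Finset.card_univ]; exact congrArg (· * t) (Fintype.card_fin s))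
  exact Finset.card_image_le.trans (by simp)

/-- A uniform function from `Fin t` is the same as `t` independent uniform coordinates, so the coins
also have product weights and the concentration bound applies to them. -/
lemma uniformLearner_prob (n s t : ℕ)
    (out : (Fin t → Fin s → Bool) → Option (Distribution (n + 1))) (D : Distribution (n + 1))
    (P : Option (Distribution (n + 1)) → Prop) :
    (uniformLearner n s t out).prob D P =
      wprob (fun z : (Fin t → Fin (n + 1)) × (Fin s → Cube (n + 1)) =>
        prodWeight (fun _ => (Fintype.card (Fin (n + 1)) : ℝ)⁻¹) t z.1 *
          prodWeight (pointMass D) s z.2)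
        (fun z => P (out fun c => columns z.2 (z.1 c))) := by
  rw [NonadaptiveLearner.prob_eq]
  have : (Fintype.card (uniformLearner n s t out).Coins : ℝ)⁻¹ =
      ((Fintype.card (Fin (n + 1)) : ℝ)⁻¹) ^ t := by
    rw [inv_pow, ← Nat.cast_pow]
    congr 2
    exact (Fintype.card_fun (α := Fin t) (β := Fin (n + 1))).trans (by simp)
  simp only [this, prodWeight, Finset.prod_const, Finset.card_univ, Fintype.card_fin]
  rfl

/-- The learner that answers with a fixed distribution, without any query. -/
def constantLearner (n : ℕ) (D : Distribution n) : NonadaptiveLearner n where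
  Coins := Unit
  samples := 0
  querySet _ _ := ∅
  output _ _ := some D

end Algorithm

/-! ### Bad events, sample sizes and the final learner -/

section Correctness

variable {n m k t : ℕ}

lemma dEM_nil (D₁ D₂ : Distribution 0) : dEM D₁ D₂ = 0 := by
  have h0 : ∀ X Y : Cube 0, dH X Y = 0 := fun X Y => by simp [dH]
  have hset : {c : ℝ | ∃ f : Cube 0 → Cube 0 → ℝ, IsFlow D₁ D₂ f ∧
      c = ∑ X, ∑ Y, f X Y * dH X Y} = {0} := by
    ext c
    constructor
    · rintro ⟨f, -, rfl⟩
      simp [h0]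
    · intro hc
      obtain ⟨f, hf, -⟩ := exists_isFlow_lt (lt_add_one (dEM D₁ D₂))
      refine ⟨f, hf, ?_⟩
      rw [Set.mem_singleton_iff.1 hc]
      simp [h0]
  rw [dEM, hset, csInf_singleton]

lemma wprob_coins_le {c : ℝ} {s : ℕ} (D : Distribution (n + 1))
    {P : (Fin t → Fin (n + 1)) → (Fin s → Cube (n + 1)) → Prop}
    (h : ∀ V, wprob (prodWeight (fun _ => (Fintype.card (Fin (n + 1)) : ℝ)⁻¹) t)
      (fun ω => P ω V) ≤ c) :
    wprob (fun z : (Fin t → Fin (n + 1)) × (Fin s → Cube (n + 1)) =>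
        prodWeight (fun _ => (Fintype.card (Fin (n + 1)) : ℝ)⁻¹) t z.1 *
          prodWeight (pointMass D) s z.2) (fun z => P z.1 z.2) ≤ c :=
  wprob_prod_le_of_left (prodWeight_nonneg (pointMass_nonneg D))
    (sum_prodWeight (sum_pointMass D) s) h

lemma sum_uniform : ∑ _x : Fin (n + 1), (Fintype.card (Fin (n + 1)) : ℝ)⁻¹ = 1 := by
  rw [Finset.sum_const, Finset.card_univ, nsmul_eq_mul, mul_inv_cancel₀]
  simp only [Fintype.card_fin]
  positivity

/-- The coins are averaged out and the batches are independent, so it suffices to bound the event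
with either batch fixed. -/
lemma wprob_batches_le {c : ℝ} (D : Distribution (n + 1))
    {P : (Fin m → Cube (n + 1)) → (Fin k → Cube (n + 1)) → Prop}
    (h : (∀ U, wprob (prodWeight (pointMass D) k) (P U) ≤ c) ∨
      ∀ Y, wprob (prodWeight (pointMass D) m) (fun U => P U Y) ≤ c) :
    wprob (fun z : (Fin t → Fin (n + 1)) × (Fin (m + k) → Cube (n + 1)) =>
        prodWeight (fun _ => (Fintype.card (Fin (n + 1)) : ℝ)⁻¹) t z.1 *
          prodWeight (pointMass D) (m + k) z.2)
        (fun z => P (firstBatch z.2) (secondBatch z.2)) ≤ c := by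
  refine wprob_prod_le_of_right (P := fun _ V => P (firstBatch V) (secondBatch V))
    (prodWeight_nonneg fun _ => by positivity) (sum_prodWeight sum_uniform t) fun _ => ?_
  refine (wprob_append (pointMass D) m k P).trans_le ?_
  rcases h with h | h
  · exact wprob_prod_le_of_right (prodWeight_nonneg (pointMass_nonneg D))
      (sum_prodWeight (sum_pointMass D) m) h
  · exact wprob_prod_le_of_left (prodWeight_nonneg (pointMass_nonneg D))
      (sum_prodWeight (sum_pointMass D) k) h

/-- The coins sample the columns of `V` inaccurately. -/
def BadCoins (α : ℝ) {s : ℕ} (ω : Fin t → Fin (n + 1)) (V : Fin s → Cube (n + 1)) : Prop :=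
  α < lOne (freq fun c => columns V (ω c)) (freq (columns V))

/-- The samples `Y` have inaccurate frequencies of the labels `g`. -/
def BadSamples (α : ℝ) {T : Type*} [Fintype T] (D : Distribution n) (g : Cube n → T)
    (Y : Fin k → Cube n) : Prop :=
  α < lOne (freq fun j => g (Y j)) (mass (pointMass D) g)

lemma dEM_le_of_not_bad {α θ : ℝ} {D D' : Distribution (n + 1)} {ω : Fin t → Fin (n + 1)}
    {V : Fin (m + (k + 1)) → Cube (n + 1)} (h1 : ¬ BadCoins α ω V)
    (h2 : ¬ BadSamples α D (nearIndex (7 * α) (firstBatch V)) (secondBatch V))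
    (h : learnFromColumns (n + 1) α θ (fun c => columns V (ω c)) = some D') :
    ∃ σ : Equiv.Perm (Fin (n + 1)), dEM D (D'.permute σ) ≤ 17 * α + θ := by
  obtain ⟨W, ⟨hW1, hW2⟩, rfl⟩ := exists_candidate_of_learnFromColumns h
  refine exists_perm_dEM_le (V := V) ?_ hW2 (not_lt.1 h2)
  have := lOne_triangle (freq (columns W)) (freq fun c => columns V (ω c)) (freq (columns V))
  have := not_lt.1 h1
  linarith

lemma exists_learn_of_not_bad {α ξ : ℝ} {s : ℕ} {D : Distribution (n + 1)}
    {ω : Fin t → Fin (n + 1)} {V : Fin (m + (k + 1)) → Cube (n + 1)} (h1 : ¬ BadCoins α ω V)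
    {g : Cube (n + 1) → Fin (s + 1)} (h0 : mass (pointMass D) g 0 ≤ ξ)
    (hg : ∀ X Y, g X = g Y → g X ≠ 0 → dH X Y ≤ 3 * α) (hm : 0 < m)
    (hU : ¬ BadSamples α D g (firstBatch V)) (hY : ¬ BadSamples α D g (secondBatch V)) :
    ∃ D', learnFromColumns (n + 1) α (ξ + 2 * α) (fun c => columns V (ω c)) = some D' := by
  refine exists_learnFromColumns_eq_some (V := V) ⟨?_, ?_⟩
  · rw [lOne_comm]; exact not_lt.1 h1
  · exact uncoveredFraction_le (pointMass_nonneg D) h0 hg hm (not_lt.1 hU) (not_lt.1 hY)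

/-- The number of samples that is enough to learn the frequencies of `N` labels. -/
noncomputable def sampleSize (α : ℝ) (N : ℕ) : ℕ := ⌈12 * (N : ℝ) ^ 2 / α ^ 2⌉₊ + 1

lemma le_sampleSize (α : ℝ) (N : ℕ) : 12 * (N : ℝ) ^ 2 / α ^ 2 ≤ sampleSize α N := by
  unfold sampleSize
  push_cast
  linarith [Nat.le_ceil (12 * (N : ℝ) ^ 2 / α ^ 2)]

lemma wprob_badSamples_le {α : ℝ} (hα : 0 < α) (D : Distribution n) {T : Type*} [Fintype T]
    (g : Cube n → T) {N : ℕ} (hN : Fintype.card T ≤ N) :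
    wprob (prodWeight (pointMass D) (sampleSize α N)) (BadSamples α D g) ≤ 1 / 12 :=
  wprob_lOne_freq_gt (pointMass_nonneg D) (sum_pointMass D) g hα (N := N) (by exact_mod_cast hN)
    (le_sampleSize α N) (Nat.succ_pos _)

lemma wprob_badCoins_le {α : ℝ} (hα : 0 < α) {s : ℕ} (V : Fin s → Cube (n + 1)) :
    wprob (prodWeight (fun _ => (Fintype.card (Fin (n + 1)) : ℝ)⁻¹) (sampleSize α (2 ^ s)))
      (fun ω => BadCoins α ω V) ≤ 1 / 12 :=
  wprob_lOne_freq_gt (fun _ => by positivity) sum_uniform (columns V) hα (N := (2 ^ s : ℕ))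
    (by simp) (le_sampleSize α _) (Nat.succ_pos _)

/-- The number of samples in the first batch. -/
noncomputable def firstSize (α : ℝ) (r : ℕ) : ℕ := sampleSize α (r + 1)

/-- The number of samples in the second batch. -/
noncomputable def secondSize (α : ℝ) (r : ℕ) : ℕ := sampleSize α (firstSize α r + r + 1)

/-- The number of coordinates queried in each sample. -/
noncomputable def coordinateCount (α : ℝ) (r : ℕ) : ℕ :=
  sampleSize α (2 ^ (firstSize α r + secondSize α r))

/-- The learner for distributions close to clusterable ones. -/
noncomputable def clusterLearner : (n : ℕ) → ℝ → ℝ → ℕ → NonadaptiveLearner n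
  | 0, _, _, _ => constantLearner 0 (PMF.pure default)
  | n + 1, α, β, r => uniformLearner n (firstSize α r + secondSize α r) (coordinateCount α r)
      (learnFromColumns (n + 1) α (β / α + 3 * α))

end Correctness

end HugeObject

/-! ### The main theorem -/

open HugeObject

/-- The bound `q` on the number of queries depends only on `α`, `β`, `r`, and not on `n`. -/
theorem corollary4p3 :
    ∃ (q : ℝ → ℝ → ℕ → ℕ)
      (A : (n : ℕ) → ℝ → ℝ → ℕ → HugeObject.NonadaptiveLearner n),
      ∀ (n : ℕ) (α β : ℝ) (r : ℕ) (ε : ℝ),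
        0 < β → β < α → ε = 17 * (3 * α + β / α) → ε < 1 →
        (A n α β r).QueriesAtMost (q α β r) ∧
        (∀ D : HugeObject.Distribution n, HugeObject.IsCloseToClusterable β α r D →
          2 / 3 ≤ (A n α β r).prob D (fun out =>
            ∃ D' : HugeObject.Distribution n, out = some D' ∧
              ∃ σ : Equiv.Perm (Fin n), HugeObject.dEM D (D'.permute σ) ≤ ε)) ∧
        (∀ D : HugeObject.Distribution n,
          (A n α β r).prob D (fun out =>
            ∃ D' : HugeObject.Distribution n, out = some D' ∧
              ∀ σ : Equiv.Perm (Fin n), ε < HugeObject.dEM D (D'.permute σ)) ≤ 1 / 3) := by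
  refine ⟨fun α _ r => (firstSize α r + secondSize α r) * coordinateCount α r, clusterLearner, ?_⟩
  rintro n α β r ε hβ hβα rfl -
  have hα : 0 < α := hβ.trans hβα
  have hζ : 0 < β / α := div_pos hβ hα
  cases n with
  -- Without coordinates there is nothing to sample uniformly, but all distances vanish and any
  -- fixed answer is correct.
  | zero =>
    have hε : 0 ≤ 17 * (3 * α + β / α) := by positivity
    refine ⟨fun ω => ?_, fun D _ => ?_, fun D => ?_⟩
    · simp [clusterLearner, constantLearner]
    · rw [NonadaptiveLearner.prob_eq_one]
      · norm_num
      · exact fun ω V => ⟨_, rfl, 1, (dEM_nil _ _).trans_le hε⟩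
    · rw [NonadaptiveLearner.prob_eq]
      refine le_of_eq_of_le (b := 0) ?_ (by norm_num)
      simp [wprob, dEM_nil, not_lt.2 hε]
  | succ n =>
    refine ⟨uniformLearner_queriesAtMost _ _ _ _, fun D hD => ?_, fun D => ?_⟩
    all_goals
      set w := fun z : (Fin (coordinateCount α r) → Fin (n + 1)) ×
          (Fin (firstSize α r + secondSize α r) → Cube (n + 1)) =>
        prodWeight (fun _ => (Fintype.card (Fin (n + 1)) : ℝ)⁻¹) (coordinateCount α r) z.1 *
          prodWeight (pointMass D) (firstSize α r + secondSize α r) z.2 with hw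
      have hw0 : ∀ z, 0 ≤ w z := fun z =>
        mul_nonneg (prodWeight_nonneg (fun _ => by positivity) _)
          (prodWeight_nonneg (pointMass_nonneg D) _)
      have hcoins : wprob w (fun z => BadCoins α z.1 z.2) ≤ 1 / 12 :=
        wprob_coins_le D (P := BadCoins α) fun V => wprob_badCoins_le hα V
      have hnear : wprob w (fun z => BadSamples α D (nearIndex (7 * α) (firstBatch z.2))
          (secondBatch z.2)) ≤ 1 / 12 :=
        wprob_batches_le D (P := fun U => BadSamples α D (nearIndex (7 * α) U))
          -- The labels are the centres and `none`, so `firstSize α r + 1` of them; `secondSize`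
          -- also leaves room for the `r + 1` cluster labels.
          (.inl fun U => wprob_badSamples_le hα D _ (by simp))
    · obtain ⟨s, hs, g, hg0, hg⟩ := hD.exists_label hα
      have hfst : wprob w (fun z => BadSamples α D g (firstBatch z.2)) ≤ 1 / 12 :=
        wprob_batches_le D (P := fun U _ => BadSamples α D g U)
          (.inr fun _ => wprob_badSamples_le hα D _ (by simp; omega))
      have hsnd : wprob w (fun z => BadSamples α D g (secondBatch z.2)) ≤ 1 / 12 :=
        wprob_batches_le D (P := fun _ Y => BadSamples α D g Y)
          (.inl fun _ => wprob_badSamples_le hα D _ (by simp; omega))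
      have hw1 : ∑ z, w z = 1 := by
        simp only [hw, Fintype.sum_prod_type, ← Finset.mul_sum, sum_prodWeight (sum_pointMass D),
          mul_one]
        exact sum_prodWeight sum_uniform _
      refine le_of_le_of_eq ?_ (uniformLearner_prob _ _ _ _ D _).symm
      rw [← sub_le_sub_iff_left 1, ← wprob_not hw1]
      refine (wprob_mono hw0 (Q := fun z => (BadCoins α z.1 z.2 ∨
        BadSamples α D (nearIndex (7 * α) (firstBatch z.2)) (secondBatch z.2)) ∨
        (BadSamples α D g (firstBatch z.2) ∨ BadSamples α D g (secondBatch z.2))) ?_).trans ?_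
      · rintro ⟨ω, V⟩ hbad
        by_contra hgood
        push Not at hgood
        obtain ⟨⟨h1, h2⟩, h3, h4⟩ := hgood
        obtain ⟨D', hD'⟩ := exists_learn_of_not_bad h1 hg0 hg (Nat.succ_pos _) h3 h4
        -- The mass `β / α + α` of label `0` and two sampling errors give the learner's threshold.
        -- The final distance is then at most `20 * α + β / α`, well below the allowed error.
        rw [show β / α + α + 2 * α = β / α + 3 * α by ring] at hD'
        obtain ⟨σ, hσ⟩ := dEM_le_of_not_bad h1 h2 hD'
        exact hbad ⟨D', hD', σ, by linarith⟩
      · have e1 := wprob_or_le hw0 (fun z => BadCoins α z.1 z.2)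
          (fun z => BadSamples α D (nearIndex (7 * α) (firstBatch z.2)) (secondBatch z.2))
        have e2 := wprob_or_le hw0 (fun z => BadSamples α D g (firstBatch z.2))
          (fun z => BadSamples α D g (secondBatch z.2))
        refine (wprob_or_le hw0 _ _).trans ?_
        linarith
    · refine le_of_eq_of_le (uniformLearner_prob _ _ _ _ D _) ?_
      refine (wprob_mono hw0 (Q := fun z => BadCoins α z.1 z.2 ∨
        BadSamples α D (nearIndex (7 * α) (firstBatch z.2)) (secondBatch z.2)) ?_).trans ?_
      · rintro ⟨ω, V⟩ ⟨D', hD', hfar⟩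
        by_contra hgood
        push Not at hgood
        obtain ⟨h1, h2⟩ := hgood
        obtain ⟨σ, hσ⟩ := dEM_le_of_not_bad h1 h2 hD'
        exact absurd (hfar σ) (by linarith)
      · refine (wprob_or_le hw0 _ _).trans ?_
        linarith
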